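/- Let $\Lambda$ be a field of characteristic $\neq 2$, or $\Lambda=\mathbb Z/2\mathbb Z$, with an involution $x\mapsto\bar x$; let $q$ be a non-negative integer and $\epsilon=(-1)^q$. Based modules and simple isomorphisms are taken with respect to the full group $Z=\widetilde K_1(\Lambda)=\operatorname{coker}(K_1(\mathbb Z)\to K_1(\Lambda))$. For a $\Lambda$-module $M$, an $\epsilon$-quadratic form on $M$ is an element of $Q_\epsilon(M)=\operatorname{coker}(1-T_\epsilon)$, where $(T_\epsilon\phi)(x)(y)=\epsilon\,\overline{\phi(y)(x)}$ for $\phi\in\operatorname{Hom}_\Lambda(M,M^*)$. Let $H_\epsilon(\Lambda^k)=\Lambda^k\oplus(\Lambda^k)^*$ be the hyperbolic form, represented by $\begin{pmatrix}0&1\\0&0\end{pmatrix}$. Let $RU_k(\Lambda,\epsilon)$ be the group generated by the simple isometries of $H_\epsilon(\Lambda^k)$ that map $\Lambda^k\times\{0\}$ onto itself by a simple automorphism, together with the flip $\begin{pmatrix}0&1\\ \epsilon&0\end{pmatrix}$ of the first hyperbolic plane (if $k\ge1$). Let $l_{2q+1}(\Lambda)$ be the set of equivalence classes of pairs $(H_\epsilon(\Lambda^k),V)$,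 $k\ge 0$, where $V\subset\Lambda^{2k}$ is a based free direct summand of rank $k$, and where $(H_\epsilon(\Lambda^k),V)$ and $(H_\epsilon(\Lambda^l),V')$ are equivalent if for some $n\ge k,l$ there is $\tau\in RU_n(\Lambda,\epsilon)$ with $\tau(V\oplus(\Lambda^{n-k}\times\{0\}))=V'\oplus(\Lambda^{n-l}\times\{0\})$ as based modules. A pair is elementary if $V\oplus(\{0\}\times\Lambda^k)=\Lambda^{2k}$ as based modules, and an element of $l_{2q+1}(\Lambda)$ is elementary if it is represented by an elementary pair. Then every element of $l_{2q+1}(\Lambda)$ is elementary. -/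

import Mathlib

/-! # The monoid `l_{2q+1}(Λ)` and its elementary elements

`Λ` is a commutative ring with an involution `star`. -/

namespace KreckMonoid

section ReducedK1

variable (Λ : Type*) [CommRing Λ]

/-- The free abelian group on all invertible matrices of all finite sizes. -/
abbrev FreeOnGL : Type _ :=
  FreeAbelianGroup (Σ n : ℕ, Matrix.GeneralLinearGroup (Fin n) Λ)

/-- The relations `[A B] = [A] + [B]` and `[A ⊕ 1] = [A]`; dividing by them produces
`K₁(Λ)`, the abelianisation of `GL(Λ) = colim GLₙ(Λ)`. -/
def k1Relations : Set (FreeOnGL Λ) :=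
  {r | ∃ (n : ℕ) (A B : Matrix.GeneralLinearGroup (Fin n) Λ),
      r = FreeAbelianGroup.of ⟨n, A * B⟩
        - (FreeAbelianGroup.of ⟨n, A⟩ + FreeAbelianGroup.of ⟨n, B⟩)} ∪
  {r | ∃ (n : ℕ) (A : Matrix.GeneralLinearGroup (Fin n) Λ)
      (B : Matrix.GeneralLinearGroup (Fin (n + 1)) Λ),
      (B : Matrix (Fin (n + 1)) (Fin (n + 1)) Λ) =
        Matrix.reindex finSumFinEquiv finSumFinEquiv
          (Matrix.fromBlocks (A : Matrix (Fin n) (Fin n) Λ) 0 0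
            (1 : Matrix (Fin 1) (Fin 1) Λ)) ∧
      r = FreeAbelianGroup.of ⟨n + 1, B⟩ - FreeAbelianGroup.of ⟨n, A⟩}

/-- The classes of invertible integral matrices, which generate the image of `K₁(ℤ)`. -/
def integralClasses : Set (FreeOnGL Λ) :=
  {r | ∃ (n : ℕ) (A : Matrix.GeneralLinearGroup (Fin n) ℤ),
      r = FreeAbelianGroup.of
        ⟨n, Matrix.GeneralLinearGroup.map (Int.castRingHom Λ) A⟩}

/-- The reduced group `coker (K₁(ℤ) → K₁(Λ))`. -/
abbrev ReducedK1 : Type _ :=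
  FreeOnGL Λ ⧸ AddSubgroup.closure (k1Relations Λ ∪ integralClasses Λ)

variable {Λ}

/-- The class of an invertible matrix in the reduced `K₁`-group. -/
def torsionClass {n : ℕ} (A : Matrix.GeneralLinearGroup (Fin n) Λ) : ReducedK1 Λ :=
  QuotientAddGroup.mk (FreeAbelianGroup.of ⟨n, A⟩)

/-- A square matrix is `Z`-simple if it is invertible and its class lies in `Z`. -/
def IsSimpleMatrix (Z : AddSubgroup (ReducedK1 Λ)) {n : ℕ}
    (A : Matrix (Fin n) (Fin n) Λ) : Prop :=
  ∃ U : Matrix.GeneralLinearGroup (Fin n) Λ,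
    (U : Matrix (Fin n) (Fin n) Λ) = A ∧ torsionClass U ∈ Z

/-- The families `b` and `c` are related by a `Z`-simple change of basis. For linearly
independent families this says that they span the same submodule and that, as bases of
this submodule, they are `Z`-equivalent. -/
def SameBasedSpan (Z : AddSubgroup (ReducedK1 Λ)) {M : Type*} [AddCommGroup M] [Module Λ M]
    {n : ℕ} (b c : Fin n → M) : Prop :=
  ∃ A : Matrix (Fin n) (Fin n) Λ, IsSimpleMatrix Z A ∧ ∀ i, b i = ∑ j, A j i • c j

end ReducedK1

section Forms

variable {Λ : Type*} [CommRing Λ] [StarRing Λ]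

/-- Asymmetric forms `M → M*`, i.e. sesquilinear forms on `M`, conjugate-linear in the
first variable and linear in the second. -/
abbrev Form (Λ : Type*) [CommRing Λ] [StarRing Λ] (M : Type*) [AddCommGroup M] [Module Λ M] :
    Type _ :=
  M →ₗ⋆[Λ] M →ₗ[Λ] Λ

/-- The sign `ε = (-1)^q`. -/
def sign (Λ : Type*) [CommRing Λ] (q : ℕ) : Λ := (-1) ^ q

lemma star_sign (q : ℕ) : star (sign Λ q) = sign Λ q := by
  simp [sign]

lemma sign_mul_self {Λ : Type*} [CommRing Λ] (q : ℕ) : sign Λ q * sign Λ q = 1 := by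
  simp [sign, ← mul_pow]

variable {M : Type*} [AddCommGroup M] [Module Λ M]

/-- The `ε`-duality involution `(T_ε φ)(x)(y) = ε * star (φ(y)(x))`. -/
def duality (q : ℕ) (φ : Form Λ M) : Form Λ M :=
  LinearMap.mk₂'ₛₗ (starRingEnd Λ) (RingHom.id Λ)
    (fun x y => sign Λ q * star (φ y x))
    (by intro x x' y; simp [mul_add])
    (by intro c x y; simp [starRingEnd_apply]; ring)
    (by intro x y y'; simp [mul_add])
    (by intro c x y; simp [starRingEnd_apply]; ring)

/-- The image of the homomorphism `1 - T_ε`. -/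
def imOneSubDuality (Λ : Type*) [CommRing Λ] [StarRing Λ] (M : Type*) [AddCommGroup M]
    [Module Λ M] (q : ℕ) : AddSubgroup (Form Λ M) where
  carrier := Set.range fun φ : Form Λ M => φ - duality q φ
  zero_mem' := ⟨0, by ext x y; simp [duality]⟩
  add_mem' := by
    rintro _ _ ⟨φ, rfl⟩ ⟨φ', rfl⟩
    exact ⟨φ + φ', by ext x y; simp [duality]; ring⟩
  neg_mem' := by
    rintro _ ⟨φ, rfl⟩
    exact ⟨-φ, by ext x y; simp [duality]; ring⟩

/-- The group `Q_ε(M) = coker (1 - T_ε)` of `ε`-quadratic forms on `M`. -/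
abbrev QuadForms (Λ : Type*) [CommRing Λ] [StarRing Λ] (M : Type*) [AddCommGroup M]
    [Module Λ M] (q : ℕ) : Type _ :=
  Form Λ M ⧸ imOneSubDuality Λ M q

/-- The pull-back `f^* ψ f` of a sesquilinear form. -/
def pullback (ψ : Form Λ M) (f : M →ₗ[Λ] M) : Form Λ M :=
  LinearMap.mk₂'ₛₗ (starRingEnd Λ) (RingHom.id Λ) (fun x y => ψ (f x) (f y))
    (by intro x x' y; simp)
    (by intro c x y; simp)
    (by intro x y y'; simp)
    (by intro c x y; simp)

/-- `f` preserves the `ε`-quadratic form represented by `ψ`. -/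
def IsIsometry (q : ℕ) (ψ : Form Λ M) (f : M ≃ₗ[Λ] M) : Prop :=
  (QuotientAddGroup.mk (pullback ψ f.toLinearMap) : QuadForms Λ M q) =
    (QuotientAddGroup.mk ψ : QuadForms Λ M q)

end Forms

section Hyperbolic

variable (Λ : Type*) [CommRing Λ] [StarRing Λ]

/-- The module `Λ^k ⊕ (Λ^k)^*` underlying `H_ε(Λ^k)`, with `(Λ^k)^*` identified with `Λ^k`
by the dual basis. -/
abbrev Hyp (k : ℕ) : Type _ := (Fin k → Λ) × (Fin k → Λ)

/-- The form `(0 1; 0 0)` on `Λ^k ⊕ (Λ^k)^*`: `ψ((x, a), (y, b)) = a(y)`. An element `a` of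
`(Λ^k)^*` with coordinates `aᵢ` in the dual basis is `y ↦ ∑ᵢ yᵢ * star aᵢ`, as `Λ` acts on the
dual module through the involution. It represents the hyperbolic `ε`-quadratic form. -/
def hypForm (k : ℕ) : Form Λ (Hyp Λ k) :=
  LinearMap.mk₂'ₛₗ (starRingEnd Λ) (RingHom.id Λ)
    (fun u v => ∑ i, star (u.2 i) * v.1 i)
    (by intro u u' v; simp [add_mul, Finset.sum_add_distrib])
    (by intro c u v; simp [starRingEnd_apply, Finset.mul_sum, mul_comm, mul_left_comm])
    (by intro u v v'; simp [mul_add, Finset.sum_add_distrib])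
    (by intro c u v; simp [Finset.mul_sum, mul_left_comm])

/-- The standard basis of `Λ^k ⊕ Λ^k`. -/
noncomputable def stdBasis (k : ℕ) : Module.Basis (Fin (k + k)) Λ (Hyp Λ k) :=
  ((Pi.basisFun Λ (Fin k)).prod (Pi.basisFun Λ (Fin k))).reindex finSumFinEquiv

/-- The Lagrangian `Λ^k × {0}`. -/
def stdLagrangian (k : ℕ) : Submodule Λ (Hyp Λ k) := Submodule.prod ⊤ ⊥

/-- The Lagrangian `{0} × Λ^k`. -/
def dualLagrangian (k : ℕ) : Submodule Λ (Hyp Λ k) := Submodule.prod ⊥ ⊤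

variable {Λ}

/-- `SU_k(Λ, ε)`: the simple isometries of `H_ε(Λ^k)`. -/
def SU (q : ℕ) (Z : AddSubgroup (ReducedK1 Λ)) (k : ℕ) : Set (Hyp Λ k ≃ₗ[Λ] Hyp Λ k) :=
  {f | IsIsometry q (hypForm Λ k) f ∧
    IsSimpleMatrix Z (LinearMap.toMatrix (stdBasis Λ k) (stdBasis Λ k) f.toLinearMap)}

/-- `TU_k(Λ, ε)`: the simple isometries preserving `Λ^k × {0}` and inducing a simple
automorphism of it. -/
def TU (q : ℕ) (Z : AddSubgroup (ReducedK1 Λ)) (k : ℕ) : Set (Hyp Λ k ≃ₗ[Λ] Hyp Λ k) :=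
  {f | f ∈ SU q Z k ∧
    (stdLagrangian Λ k).map f.toLinearMap = stdLagrangian Λ k ∧
    IsSimpleMatrix Z (LinearMap.toMatrix'
      (LinearMap.fst Λ (Fin k → Λ) (Fin k → Λ) ∘ₗ f.toLinearMap ∘ₗ
        LinearMap.inl Λ (Fin k → Λ) (Fin k → Λ)))}

/-- The flip `(0 1; ε 0)` on the `i`-th hyperbolic plane, the identity on the others. -/
def flip (q : ℕ) {k : ℕ} (i : Fin k) : Hyp Λ k ≃ₗ[Λ] Hyp Λ k where
  toFun u := (fun j => if j = i then u.2 j else u.1 j,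
    fun j => if j = i then sign Λ q * u.1 j else u.2 j)
  invFun u := (fun j => if j = i then sign Λ q * u.2 j else u.1 j,
    fun j => if j = i then u.1 j else u.2 j)
  map_add' u v := by
    ext j <;> by_cases h : j = i <;> simp [h, mul_add]
  map_smul' c u := by
    ext j <;> by_cases h : j = i <;> simp [h, mul_left_comm]
  left_inv u := by
    ext j <;> by_cases h : j = i <;> simp [h, ← mul_assoc, sign_mul_self]
  right_inv u := by
    ext j <;> by_cases h : j = i <;> simp [h, ← mul_assoc, sign_mul_self]

/-- `RU_k(Λ, ε)`: the group generated by `TU_k(Λ, ε)` and the flip `σ_k` of the first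
hyperbolic plane (if there is one). -/
def RU (q : ℕ) (Z : AddSubgroup (ReducedK1 Λ)) (k : ℕ) :
    Subgroup (Hyp Λ k ≃ₗ[Λ] Hyp Λ k) :=
  Subgroup.closure (TU q Z k ∪ {f | ∃ h : 0 < k, f = flip q ⟨0, h⟩})

/-- The inclusion `Λ^k → Λ^n` onto the first coordinates. -/
def extend {k : ℕ} (n : ℕ) (x : Fin k → Λ) : Fin n → Λ :=
  fun j => if h : (j : ℕ) < k then x ⟨j, h⟩ else 0

variable (Λ)

/-- A pair `(H_ε(Λ^k), V)`: a based free direct summand `V ⊆ Λ^{2k}` of rank `k`. Pairs whose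
bases are `Z`-equivalent become equal in the quotient below. -/
structure Pair where
  k : ℕ
  V : Submodule Λ (Hyp Λ k)
  basis : Module.Basis (Fin k) Λ V
  summand : ∃ W : Submodule Λ (Hyp Λ k), IsCompl V W

variable {Λ}

/-- The basis of `V ⊕ (Λ^{n-k} × {0}) ⊆ Λ^{2n}` made up of the basis of `V` and the standard
basis of `Λ^{n-k}`, for `k ≤ n`. -/
noncomputable def Pair.stabBasis (p : Pair Λ) (n : ℕ) : Fin n → Hyp Λ n :=
  fun i => if h : (i : ℕ) < p.k then
      (extend n (p.basis ⟨i, h⟩ : Hyp Λ p.k).1, extend n (p.basis ⟨i, h⟩ : Hyp Λ p.k).2)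
    else (Pi.single i 1, 0)

/-- `(H_ε(Λ^k), V)` and `(H_ε(Λ^l), V')` are equivalent if, for some `n` and some
`τ ∈ RU_n(Λ, ε)`, `τ(V ⊕ (Λ^{n-k} × {0})) = V' ⊕ (Λ^{n-l} × {0})` as based modules. -/
def Pair.Equivalent (q : ℕ) (Z : AddSubgroup (ReducedK1 Λ)) (p p' : Pair Λ) : Prop :=
  ∃ n : ℕ, p.k ≤ n ∧ p'.k ≤ n ∧ ∃ τ ∈ RU q Z n,
    SameBasedSpan Z (fun i => τ (p.stabBasis n i)) (p'.stabBasis n)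

/-- A pair `(H_ε(Λ^k), V)` is elementary if `V ⊕ ({0} × Λ^k) = Λ^{2k}` as based modules. -/
def Pair.IsElementary (Z : AddSubgroup (ReducedK1 Λ)) (p : Pair Λ) : Prop :=
  IsCompl p.V (dualLagrangian Λ p.k) ∧
  IsSimpleMatrix Z ((stdBasis Λ p.k).toMatrix
    (Fin.append (fun i => (p.basis i : Hyp Λ p.k))
      (fun i => ((0, Pi.single i 1) : Hyp Λ p.k))))

/-- The set `l_{2q+1}(Λ)` of equivalence classes of pairs, with respect to the subgroup `Z` of
the reduced `K₁`-group. -/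
def OddMonoid (Λ : Type*) [CommRing Λ] [StarRing Λ] (q : ℕ) (Z : AddSubgroup (ReducedK1 Λ)) :
    Type _ :=
  Quot (Pair.Equivalent (Λ := Λ) q Z)

/-- An element of `l_{2q+1}(Λ)` is elementary if it has an elementary representative. -/
def OddMonoid.IsElementary {q : ℕ} {Z : AddSubgroup (ReducedK1 Λ)} (x : OddMonoid Λ q Z) :
    Prop :=
  ∃ p : Pair Λ, Quot.mk _ p = x ∧ p.IsElementary Z

end Hyperbolic

end KreckMonoid

/-! With respect to the full group `Z` every invertible matrix is simple, so over a field a pair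
`(H_ε(Λ^k), V)` is elementary as soon as `V` meets the dual Lagrangian `{0} × Λ^k` trivially.
Suppose that `V` contains `(0, a)` with `a ≠ 0`. Since `dim V = k`, the projection `P` of `V` to
`Λ^k` is then a proper subspace, so there is a basis `b₀, b₁, …` of `Λ^k` such that `P` is contained
in the span of `b₁, b₂, …` and `a(b₀) ≠ 0`. Apply the hyperbolic isometry that carries `b` to the
standard basis, then the flip. The flip replaces the first coordinate of `Λ^k`, which vanishes on
the image of `V`, by the dual coordinate `(x, c) ↦ c(b₀)`. So no new vector of `V` gets into the
dual Lagrangian, and `(0, a)` leaves it. Iterating makes the intersection trivial. -/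

namespace KreckMonoid

section LinearAlgebra

open Module

lemma exists_notMem_and_notMem {R M : Type*} [Ring R] [AddCommGroup M] [Module R M]
    {P Q : Submodule R M} (hP : P ≠ ⊤) (hQ : Q ≠ ⊤) : ∃ x, x ∉ P ∧ x ∉ Q := by
  by_contra! h
  have hcover : ((⊤ : Submodule R M) : Set M) ⊆ P ∪ Q := fun x _ => or_iff_not_imp_left.2 (h x)
  exact (AddSubgroupClass.subset_union.1 hcover).elim (hP ∘ top_le_iff.1) (hQ ∘ top_le_iff.1)

variable {K V : Type*} [DivisionRing K] [AddCommGroup V] [Module K V]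

lemma exists_basis_apply_zero_and_coord_zero_eq {n : ℕ}
    (hn : finrank K V = n + 1) {φ : Dual K V} {v : V} (hv : φ v = 1) :
    ∃ b : Basis (Fin (n + 1)) K V, b 0 = v ∧ b.coord 0 = φ := by
  have := FiniteDimensional.of_finrank_eq_succ hn
  have hφ : φ ≠ 0 := by
    rintro rfl
    simp at hv
  have hker : finrank K (LinearMap.ker φ) = n := by
    have := Dual.finrank_ker_add_one_of_ne_zero hφ
    omega
  let c := finBasisOfFinrankEq K (LinearMap.ker φ) hker
  let b := Basis.mkFinCons v c
    (fun a x hx h => by simpa [hv, LinearMap.mem_ker.1 hx] using congrArg φ h)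
    (fun x => ⟨-φ x, by simp [hv]⟩)
  have hb : ⇑b = Fin.cons v (Subtype.val ∘ c) := Basis.coe_mkFinCons v c _ _
  have hb0 : b 0 = v := by rw [hb, Fin.cons_zero]
  refine ⟨b, hb0, b.ext (Fin.cases ?_ fun i => ?_)⟩
  · rw [Basis.coord_apply, Basis.repr_self, Finsupp.single_eq_same, hb0, hv]
  · have hφb : φ (b i.succ) = 0 := by
      rw [hb, Fin.cons_succ]
      exact (c i).2
    simp [hφb]

lemma exists_basis_le_ker_coord_zero_and_apply_zero_ne_zero {n : ℕ}
    (hn : finrank K V = n + 1) {P : Submodule K V} (hP : P ≠ ⊤) {ψ : Dual K V} (hψ : ψ ≠ 0) :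
    ∃ b : Basis (Fin (n + 1)) K V, P ≤ LinearMap.ker (b.coord 0) ∧ ψ (b 0) ≠ 0 := by
  obtain ⟨v, hvP, hvψ⟩ := exists_notMem_and_notMem hP (mt LinearMap.ker_eq_top.1 hψ)
  obtain ⟨φ, hφv, hφP⟩ := P.exists_le_ker_of_notMem hvP
  obtain ⟨b, hb, hbφ⟩ := exists_basis_apply_zero_and_coord_zero_eq hn
    (φ := φ) (v := (φ v)⁻¹ • v) (by simp [hφv])
  exact ⟨b, hbφ ▸ hφP, by simpa [hb, hφv] using hvψ⟩

lemma finrank_map_inf_lt [FiniteDimensional K V] (τ : V ≃ₗ[K] V) {W D : Submodule K V}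
    (hWD : ∀ w ∈ W, τ w ∈ D → w ∈ D) {u : V} (huW : u ∈ W) (huD : u ∈ D) (hτu : τ u ∉ D) :
    finrank K (W.map τ.toLinearMap ⊓ D : Submodule K V) <
      finrank K (W ⊓ D : Submodule K V) := by
  have hlt : W ⊓ D.comap τ.toLinearMap < W ⊓ D :=
    lt_of_le_not_ge (le_inf inf_le_left fun w hw => hWD w hw.1 hw.2)
      fun hle => hτu (hle ⟨huW, huD⟩).2
  calc finrank K (W.map τ.toLinearMap ⊓ D : Submodule K V)
      = finrank K ((W ⊓ D.comap τ.toLinearMap).map τ.toLinearMap) := by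
        rw [Submodule.map_inf_eq_map_inf_comap]
    _ = finrank K (W ⊓ D.comap τ.toLinearMap : Submodule K V) := LinearEquiv.finrank_map_eq τ _
    _ < finrank K (W ⊓ D : Submodule K V) := Submodule.finrank_lt_finrank_of_lt hlt

end LinearAlgebra

section Simple

variable {Λ : Type*} [CommRing Λ]

lemma isSimpleMatrix_top_iff {n : ℕ} {A : Matrix (Fin n) (Fin n) Λ} :
    IsSimpleMatrix (⊤ : AddSubgroup (ReducedK1 Λ)) A ↔ IsUnit A :=
  ⟨fun ⟨U, hU, _⟩ => ⟨U, hU⟩, fun ⟨U, hU⟩ => ⟨U, hU, AddSubgroup.mem_top _⟩⟩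

lemma torsionClass_one (n : ℕ) :
    torsionClass (1 : Matrix.GeneralLinearGroup (Fin n) Λ) = 0 :=
  (QuotientAddGroup.eq_zero_iff _).2 (AddSubgroup.subset_closure (Or.inr ⟨n, 1, by simp⟩))

lemma isSimpleMatrix_one (Z : AddSubgroup (ReducedK1 Λ)) (n : ℕ) :
    IsSimpleMatrix Z (1 : Matrix (Fin n) (Fin n) Λ) :=
  ⟨1, rfl, torsionClass_one (Λ := Λ) n ▸ Z.zero_mem⟩

lemma SameBasedSpan.refl (Z : AddSubgroup (ReducedK1 Λ)) {M : Type*} [AddCommGroup M]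
    [Module Λ M] {n : ℕ} (b : Fin n → M) : SameBasedSpan Z b b :=
  ⟨1, isSimpleMatrix_one Z n, fun i => by simp [Matrix.one_apply]⟩

end Simple

section Pairs

variable {Λ : Type*} [CommRing Λ]

lemma mem_dualLagrangian {k : ℕ} {u : Hyp Λ k} : u ∈ dualLagrangian Λ k ↔ u.1 = 0 := by
  simp [dualLagrangian]

lemma dualLagrangian_eq_ker_fst (k : ℕ) :
    dualLagrangian Λ k = LinearMap.ker (LinearMap.fst Λ (Fin k → Λ) (Fin k → Λ)) :=
  Submodule.ext fun _ => mem_dualLagrangian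

lemma map_fst_ne_top [IsDomain Λ] {k : ℕ} {W : Submodule Λ (Hyp Λ k)} [Module.Finite Λ W]
    (hW : Module.finrank Λ W ≤ k) (hWD : ¬Disjoint W (dualLagrangian Λ k)) :
    W.map (LinearMap.fst Λ (Fin k → Λ) (Fin k → Λ)) ≠ ⊤ := by
  intro htop
  rw [dualLagrangian_eq_ker_fst] at hWD
  exact hWD (Submodule.disjoint_ker_of_finrank_le _ (by
    rwa [htop, finrank_top, Module.finrank_fin_fun]))

/-- The standard basis of the dual Lagrangian `{0} × Λ^k`. It extends a basis of a complement to
the basis of `H_ε(Λ^k)` in the definition of elementary pairs. -/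
noncomputable def dualLagrangianBasis (Λ : Type*) [CommRing Λ] (k : ℕ) :
    Module.Basis (Fin k) Λ (dualLagrangian Λ k) :=
  (Pi.basisFun Λ (Fin k)).map
    ((LinearEquiv.ofInjective _ LinearMap.inr_injective).trans
      (LinearEquiv.ofEq _ _ ((LinearMap.range_inr ..).trans (dualLagrangian_eq_ker_fst k).symm)))

lemma coe_dualLagrangianBasis {k : ℕ} (i : Fin k) :
    (dualLagrangianBasis Λ k i : Hyp Λ k) = (0, Pi.single i 1) := by
  simp [dualLagrangianBasis]

lemma Pair.isElementary_top_iff {p : Pair Λ} :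
    p.IsElementary (⊤ : AddSubgroup (ReducedK1 Λ)) ↔ IsCompl p.V (dualLagrangian Λ p.k) := by
  refine ⟨And.left, fun h => ⟨h, isSimpleMatrix_top_iff.2 ?_⟩⟩
  let B : Module.Basis (Fin (p.k + p.k)) Λ (Hyp Λ p.k) :=
    ((p.basis.prod (dualLagrangianBasis Λ p.k)).map
      (Submodule.prodEquivOfIsCompl _ _ h)).reindex finSumFinEquiv
  have hB : ⇑B = Fin.append (fun i => (p.basis i : Hyp Λ p.k))
      (fun i => ((0, Pi.single i 1) : Hyp Λ p.k)) := by
    funext i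
    refine Fin.addCases (fun i => ?_) (fun i => ?_) i <;>
      simp [B, coe_dualLagrangianBasis, -Fin.natAdd_eq_addNat]
  rw [← hB]
  exact IsUnit.of_mul_eq_one _ (Module.Basis.toMatrix_mul_toMatrix_flip _ _)

lemma Pair.finrank_eq [Nontrivial Λ] (p : Pair Λ) : Module.finrank Λ p.V = p.k := by
  rw [Module.finrank_eq_card_basis p.basis, Fintype.card_fin]

lemma extend_self {k : ℕ} (x : Fin k → Λ) : extend k x = x := by
  ext j
  simp [extend]

lemma Pair.stabBasis_self (p : Pair Λ) : p.stabBasis p.k = fun i => (p.basis i : Hyp Λ p.k) := by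
  ext i <;> simp [Pair.stabBasis, extend_self]

/-- The image `(H_ε(Λ^k), τ(V))` of a pair under an automorphism `τ` of the module `Λ^k ⊕ (Λ^k)^*`,
based by the image of the basis of `V`. For `τ ∈ RU_k(Λ, ε)` it represents the same element of
`l_{2q+1}(Λ)`. -/
noncomputable def Pair.map (p : Pair Λ) (τ : Hyp Λ p.k ≃ₗ[Λ] Hyp Λ p.k) : Pair Λ where
  k := p.k
  V := p.V.map τ.toLinearMap
  basis := p.basis.map (τ.submoduleMap p.V)
  summand := p.summand.imp' _ fun _ h => (Submodule.orderIsoMapComap τ).isCompl h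

lemma Pair.equivalent_map [StarRing Λ] {q : ℕ} {Z : AddSubgroup (ReducedK1 Λ)} (p : Pair Λ)
    {τ : Hyp Λ p.k ≃ₗ[Λ] Hyp Λ p.k} (hτ : τ ∈ RU q Z p.k) : p.Equivalent q Z (p.map τ) := by
  refine ⟨p.k, le_rfl, le_rfl, τ, hτ, ?_⟩
  have hstab : (p.map τ).stabBasis p.k = fun i => τ (p.stabBasis p.k i) := by
    rw [p.stabBasis_self]
    exact (p.map τ).stabBasis_self
  rw [hstab]
  exact SameBasedSpan.refl Z _

end Pairs

section HyperbolicIsometry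

open scoped Matrix

variable {Λ : Type*} [CommRing Λ] [StarRing Λ] {n : ℕ}

/-- The automorphism `(g⁻¹)^*` of `(Λ^n)^*` by which the hyperbolic isometry of `g` acts on the
dual summand. In the coordinates `aᵢ` of `hypForm` it is the conjugate transpose of `g⁻¹`. -/
noncomputable def contragredient (g : (Fin n → Λ) ≃ₗ[Λ] (Fin n → Λ)) :
    (Fin n → Λ) ≃ₗ[Λ] (Fin n → Λ) :=
  Matrix.toLin'OfInv (M' := (LinearMap.toMatrix' g.symm.toLinearMap)ᴴ)
    (M := (LinearMap.toMatrix' g.toLinearMap)ᴴ)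
    (by rw [← Matrix.conjTranspose_mul, ← LinearMap.toMatrix'_comp]; simp)
    (by rw [← Matrix.conjTranspose_mul, ← LinearMap.toMatrix'_comp]; simp)

lemma star_contragredient_dotProduct (g : (Fin n → Λ) ≃ₗ[Λ] (Fin n → Λ)) (a x : Fin n → Λ) :
    star (contragredient g a) ⬝ᵥ x = star a ⬝ᵥ g.symm x := by
  change star ((LinearMap.toMatrix' g.symm.toLinearMap)ᴴ *ᵥ a) ⬝ᵥ x = _
  rw [Matrix.star_mulVec, Matrix.conjTranspose_conjTranspose, ← Matrix.dotProduct_mulVec,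
    LinearMap.toMatrix'_mulVec]
  rfl

/-- The hyperbolic isometry `H(g) = g ⊕ (g⁻¹)^*` of `H_ε(Λ^n)` induced by an automorphism `g`
of `Λ^n`. These are the elements of `TU_n(Λ, ε)` that move `V` into position for the flip. -/
noncomputable def hyperbolicEquiv (g : (Fin n → Λ) ≃ₗ[Λ] (Fin n → Λ)) :
    Hyp Λ n ≃ₗ[Λ] Hyp Λ n :=
  g.prodCongr (contragredient g)

lemma hypForm_hyperbolicEquiv (g : (Fin n → Λ) ≃ₗ[Λ] (Fin n → Λ)) (u v : Hyp Λ n) :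
    hypForm Λ n (hyperbolicEquiv g u) (hyperbolicEquiv g v) = hypForm Λ n u v := by
  change star (contragredient g u.2) ⬝ᵥ g v.1 = star u.2 ⬝ᵥ v.1
  rw [star_contragredient_dotProduct, g.symm_apply_apply]

lemma map_hyperbolicEquiv_stdLagrangian (g : (Fin n → Λ) ≃ₗ[Λ] (Fin n → Λ)) :
    (stdLagrangian Λ n).map (hyperbolicEquiv g).toLinearMap = stdLagrangian Λ n := by
  simp [stdLagrangian, hyperbolicEquiv, LinearMap.prodMap_map_prod]

lemma hyperbolicEquiv_mem_TU (q : ℕ) (g : (Fin n → Λ) ≃ₗ[Λ] (Fin n → Λ)) :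
    hyperbolicEquiv g ∈ TU q (⊤ : AddSubgroup (ReducedK1 Λ)) n := by
  refine ⟨⟨?_, isSimpleMatrix_top_iff.2 ?_⟩, map_hyperbolicEquiv_stdLagrangian g,
    isSimpleMatrix_top_iff.2 ?_⟩
  · exact congrArg _ (LinearMap.ext₂ (hypForm_hyperbolicEquiv g))
  · exact (LinearMap.isUnit_toMatrix_iff _).2
      ((Module.End.isUnit_iff _).2 (hyperbolicEquiv g).bijective)
  · exact LinearMap.isUnit_toMatrix'_iff.2 ((Module.End.isUnit_iff _).2 g.bijective)

lemma flip_hyperbolicEquiv_mem_dualLagrangian_iff (q : ℕ)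
    (g : (Fin n → Λ) ≃ₗ[Λ] (Fin n → Λ)) (i : Fin n) (w : Hyp Λ n) :
    flip q i (hyperbolicEquiv g w) ∈ dualLagrangian Λ n ↔
      star w.2 ⬝ᵥ g.symm (Pi.single i 1) = 0 ∧ ∀ j ≠ i, g w.1 j = 0 := by
  have hself : (flip q i (hyperbolicEquiv g w)).1 i = contragredient g w.2 i := if_pos rfl
  have hne : ∀ j ≠ i, (flip q i (hyperbolicEquiv g w)).1 j = g w.1 j := fun _ hj => if_neg hj
  rw [← star_contragredient_dotProduct, dotProduct_single_one, Pi.star_apply, star_eq_zero,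
    mem_dualLagrangian, funext_iff, ← and_forall_ne i, hself]
  exact and_congr Iff.rfl (forall₂_congr fun j hj => by rw [hne j hj, Pi.zero_apply])

end HyperbolicIsometry

section Field

open Module

variable {Λ : Type*} [Field Λ] {n : ℕ} {W : Submodule Λ (Hyp Λ n)}

lemma Pair.isElementary_of_disjoint {p : Pair Λ} (h : Disjoint p.V (dualLagrangian Λ p.k)) :
    p.IsElementary (⊤ : AddSubgroup (ReducedK1 Λ)) := by
  have hdim : finrank Λ (Hyp Λ p.k) ≤ finrank Λ p.V + finrank Λ (dualLagrangian Λ p.k) := by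
    rw [p.finrank_eq, finrank_eq_card_basis (dualLagrangianBasis Λ p.k)]
    simp
  exact Pair.isElementary_top_iff.2 ((Submodule.isCompl_iff_disjoint _ _ hdim).2 h)

variable [StarRing Λ]

lemma exists_mem_RU_finrank_map_inf_lt (q : ℕ) (hW : finrank Λ W ≤ n)
    (hWD : ¬Disjoint W (dualLagrangian Λ n)) :
    ∃ τ ∈ RU q (⊤ : AddSubgroup (ReducedK1 Λ)) n,
      finrank Λ (W.map τ.toLinearMap ⊓ dualLagrangian Λ n : Submodule Λ (Hyp Λ n)) <
        finrank Λ (W ⊓ dualLagrangian Λ n : Submodule Λ (Hyp Λ n)) := by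
  have hP := map_fst_ne_top hW hWD
  obtain ⟨u, ⟨huW, huD⟩, hu⟩ := (Submodule.ne_bot_iff _).1 (mt disjoint_iff.2 hWD)
  have hu2 : u.2 ≠ 0 := fun h => hu (Prod.ext (mem_dualLagrangian.1 huD) h)
  obtain _ | m := n
  · exact absurd (Subsingleton.elim _ _) hu2
  obtain ⟨b, hbP, hub⟩ := exists_basis_le_ker_coord_zero_and_apply_zero_ne_zero
    (finrank_fin_fun Λ) hP (ψ := dotProductEquiv Λ _ (star u.2)) (by simpa using hu2)
  have hcoord : ∀ w ∈ W, b.equivFun w.1 0 = 0 := fun w hw => hbP ⟨w, hw, rfl⟩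
  have hmem := flip_hyperbolicEquiv_mem_dualLagrangian_iff q b.equivFun 0
  have hhyp : hyperbolicEquiv b.equivFun ∈ RU q (⊤ : AddSubgroup (ReducedK1 Λ)) (m + 1) :=
    Subgroup.subset_closure (Or.inl (hyperbolicEquiv_mem_TU q _))
  have hflip : flip q 0 ∈ RU q (⊤ : AddSubgroup (ReducedK1 Λ)) (m + 1) :=
    Subgroup.subset_closure (Or.inr ⟨m.succ_pos, rfl⟩)
  refine ⟨_, mul_mem hflip hhyp, finrank_map_inf_lt _ (fun w hw hτw => ?_) huW huD fun hτu => ?_⟩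
  · rw [mem_dualLagrangian, ← LinearEquiv.map_eq_zero_iff b.equivFun]
    funext j
    obtain rfl | hj := eq_or_ne j 0
    · exact hcoord w hw
    · exact ((hmem w).1 hτw).2 j hj
  · exact hub (by simpa using ((hmem u).1 hτu).1)

lemma exists_mem_RU_disjoint_map (q : ℕ) (hW : finrank Λ W ≤ n) :
    ∃ τ ∈ RU q (⊤ : AddSubgroup (ReducedK1 Λ)) n,
      Disjoint (W.map τ.toLinearMap) (dualLagrangian Λ n) := by
  induction h : finrank Λ (W ⊓ dualLagrangian Λ n : Submodule Λ (Hyp Λ n))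
    using Nat.strong_induction_on generalizing W with
  | _ d ih =>
    by_cases hWD : Disjoint W (dualLagrangian Λ n)
    · exact ⟨1, one_mem _, (Submodule.map_id W).symm ▸ hWD⟩
    · obtain ⟨τ, hτ, hlt⟩ := exists_mem_RU_finrank_map_inf_lt q hW hWD
      obtain ⟨τ', hτ', hdisj⟩ := ih _ (h ▸ hlt) ((LinearEquiv.finrank_map_eq τ W).trans_le hW) rfl
      refine ⟨τ' * τ, mul_mem hτ' hτ, ?_⟩
      rwa [← Submodule.map_comp] at hdisj

end Field

end KreckMonoid

open KreckMonoid in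
theorem mainTheorem9_general {Λ : Type*} [Field Λ] [StarRing Λ] (q : ℕ)
    (x : OddMonoid Λ q (⊤ : AddSubgroup (ReducedK1 Λ))) : x.IsElementary := by
  obtain ⟨p, rfl⟩ := Quot.exists_rep x
  obtain ⟨τ, hτ, hdisj⟩ := exists_mem_RU_disjoint_map q p.finrank_eq.le
  exact ⟨p.map τ, (Quot.sound (p.equivalent_map hτ)).symm, Pair.isElementary_of_disjoint hdisj⟩

theorem mainTheorem9 {Λ : Type*} [Field Λ] [StarRing Λ]
    (hΛ : ringChar Λ ≠ 2 ∨ Nonempty (Λ ≃+* ZMod 2)) (q : ℕ)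
    (x : KreckMonoid.OddMonoid Λ q (⊤ : AddSubgroup (KreckMonoid.ReducedK1 Λ))) :
    x.IsElementary :=
  mainTheorem9_general q x
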